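/- Let $G$ be a finite cyclic group of order $n$ and let $K$ be an algebraically closed field of characteristic $0$. For a finite group $A$, let the representation ring $R_K(A)$ be the quotient of the free abelian group on the isomorphism classes $[V]$ of finite dimensional $K$-representations of $A$ by the subgroup generated by all elements $[V]+[W]-[V\oplus W]$, with the multiplication determined by $[V]\cdot[W]=[V\otimes_K W]$ and with identity the class of the trivial representation $K$. For a subgroup $H\le G$, let $\mathrm{Ind}_H^G\colon R_K(H)\to R_K(G)$ be the homomorphism of abelian groups that sends $[W]$ to the class of the induced representation $K[G]\otimes_{K[H]}W$; its image $\mathrm{Ind}_H^G(R_K(H))$ is an ideal of $R_K(G)$. Then there is an isomorphism of rings $$\frac{R_K(G)}{\sum_{H<G}\mathrm{Ind}_H^G(R_K(H))}\;\cong\;\frac{\mathbb{Z}[X]}{\langle\Phi_n(X)\rangle},$$ where $H$ ranges over all proper subgroups of $G$ and $\Phi_n$ denotes the $n$-th cyclotomic polynomial. -/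

import Mathlib

open scoped TensorProduct MonoidAlgebra

universe u v w w'

noncomputable section

/-! ### Isomorphism classes of finite dimensional representations -/

/-- Isomorphism of representations, on the representations whose space is some `Kⁿ`. -/
instance finDimRepSetoid (K : Type u) (G : Type v) [Field K] [Group G] :
    Setoid (Σ n : ℕ, Representation K G (Fin n → K)) where
  r x y := Nonempty (x.2.Equiv y.2)
  iseqv := ⟨fun _ => ⟨.refl _⟩, fun ⟨e⟩ => ⟨e.symm⟩, fun ⟨e⟩ ⟨f⟩ => ⟨e.trans f⟩⟩

/-- The set of isomorphism classes of finite dimensional `K`-representations of `G`. So that this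
is a type in a definite universe, it is built from the representations on the spaces `Kⁿ`; every
finite dimensional representation, in any universe, has a class in it (`isoClass`), and two of them
have the same class exactly when they are isomorphic (`isoClass_eq_iff`). -/
def IsoClass (K : Type u) (G : Type v) [Field K] [Group G] : Type (max u v) :=
  Quotient (finDimRepSetoid K G)

section IsoClass

variable {K : Type u} {G : Type v} [Field K] [Group G]
variable {V : Type*} [AddCommGroup V] [Module K V] [Module.Finite K V]
variable {W : Type*} [AddCommGroup W] [Module K W] [Module.Finite K W]
variable {U : Type*} [AddCommGroup U] [Module K U] [Module.Finite K U]
variable {V' : Type*} [AddCommGroup V'] [Module K V'] [Module.Finite K V']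
variable {W' : Type*} [AddCommGroup W'] [Module K W'] [Module.Finite K W']

/-- A representation written in coordinates for a basis of its space. -/
def coordRep (ρ : Representation K G V) :
    Representation K G (Fin (Module.finrank K V) → K) where
  toFun g := (Module.finBasis K V).equivFun.conj (ρ g)
  map_one' := by
    refine LinearMap.ext fun x => ?_
    simp only [LinearEquiv.conj_apply_apply, map_one, Module.End.one_apply,
      LinearEquiv.apply_symm_apply]
  map_mul' g h := by
    refine LinearMap.ext fun x => ?_
    simp only [LinearEquiv.conj_apply_apply, map_mul, Module.End.mul_apply,
      LinearEquiv.symm_apply_apply]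

/-- A representation is isomorphic to its coordinate form. -/
def coordRepEquiv (ρ : Representation K G V) : ρ.Equiv (coordRep ρ) :=
  .mk (Module.finBasis K V).equivFun fun g => by
    ext x : 1
    simp [coordRep, LinearEquiv.conj_apply]

/-- The isomorphism class `[(ρ, V)]` of a finite dimensional representation. -/
def isoClass (ρ : Representation K G V) : IsoClass K G :=
  Quotient.mk _ ⟨_, coordRep ρ⟩

theorem isoClass_eq_iff {ρ : Representation K G V} {σ : Representation K G W} :
    isoClass ρ = isoClass σ ↔ Nonempty (ρ.Equiv σ) := by
  refine (Quotient.eq (r := finDimRepSetoid K G)).trans ?_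
  exact ⟨fun ⟨e⟩ => ⟨((coordRepEquiv ρ).trans e).trans (coordRepEquiv σ).symm⟩,
    fun ⟨e⟩ => ⟨((coordRepEquiv ρ).symm.trans e).trans (coordRepEquiv σ)⟩⟩

theorem isoClass_eq {ρ : Representation K G V} {σ : Representation K G W} (e : ρ.Equiv σ) :
    isoClass ρ = isoClass σ := isoClass_eq_iff.2 ⟨e⟩

theorem mk_eq_isoClass (x : Σ n : ℕ, Representation K G (Fin n → K)) :
    (Quotient.mk _ x : IsoClass K G) = isoClass x.2 :=
  Quotient.sound ⟨coordRepEquiv x.2⟩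

theorem IsoClass.ind {p : IsoClass K G → Prop}
    (h : ∀ (n : ℕ) (ρ : Representation K G (Fin n → K)), p (isoClass ρ)) (x : IsoClass K G) :
    p x := by
  induction x using Quotient.ind with
  | _ x => rw [mk_eq_isoClass]; exact h _ _

/-- Direct sums of isomorphic representations are isomorphic. -/
def prodEquiv {ρ : Representation K G V} {ρ' : Representation K G V'}
    {σ : Representation K G W} {σ' : Representation K G W'}
    (e : ρ.Equiv ρ') (f : σ.Equiv σ') : (ρ.prod σ).Equiv (ρ'.prod σ') :=
  .mk (e.toLinearEquiv.prodCongr f.toLinearEquiv) fun g => by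
    ext x <;> simp [e.toIntertwiningMap.isIntertwining, f.toIntertwiningMap.isIntertwining]

/-- Tensor products of isomorphic representations are isomorphic. -/
def tprodEquiv {ρ : Representation K G V} {ρ' : Representation K G V'}
    {σ : Representation K G W} {σ' : Representation K G W'}
    (e : ρ.Equiv ρ') (f : σ.Equiv σ') : (ρ.tprod σ).Equiv (ρ'.tprod σ') :=
  .mk (TensorProduct.congr e.toLinearEquiv f.toLinearEquiv) fun g => by
    ext x y; simp [e.toIntertwiningMap.isIntertwining, f.toIntertwiningMap.isIntertwining]

/-- The tensor product distributes over direct sums. -/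
def tprodProdEquiv (ρ : Representation K G V) (σ : Representation K G W)
    (τ : Representation K G U) :
    (ρ.tprod (σ.prod τ)).Equiv ((ρ.tprod σ).prod (ρ.tprod τ)) :=
  .mk (TensorProduct.prodRight K K V W U) fun g => by
    ext x y <;> simp

/-- `[V] + [W] := [V ⊕ W]` on isomorphism classes. -/
instance : Add (IsoClass K G) where
  add := Quotient.lift₂ (fun x y => isoClass (x.2.prod y.2))
    fun _ _ _ _ ⟨e⟩ ⟨f⟩ => isoClass_eq (prodEquiv e f)

/-- `[V] * [W] := [V ⊗ W]` on isomorphism classes. -/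
instance : Mul (IsoClass K G) where
  mul := Quotient.lift₂ (fun x y => isoClass (x.2.tprod y.2))
    fun _ _ _ _ ⟨e⟩ ⟨f⟩ => isoClass_eq (tprodEquiv e f)

/-- `1 := [K]`, the class of the trivial one dimensional representation. -/
instance : One (IsoClass K G) where
  one := isoClass (Representation.trivial K G K)

theorem isoClass_prod (ρ : Representation K G V) (σ : Representation K G W) :
    isoClass (ρ.prod σ) = isoClass ρ + isoClass σ :=
  isoClass_eq (prodEquiv (coordRepEquiv ρ) (coordRepEquiv σ))

theorem isoClass_tprod (ρ : Representation K G V) (σ : Representation K G W) :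
    isoClass (ρ.tprod σ) = isoClass ρ * isoClass σ :=
  isoClass_eq (tprodEquiv (coordRepEquiv ρ) (coordRepEquiv σ))

theorem isoClass_trivial : isoClass (Representation.trivial K G K) = 1 := rfl

instance : CommMonoid (IsoClass K G) where
  mul_assoc x y z := by
    induction x using IsoClass.ind
    induction y using IsoClass.ind
    induction z using IsoClass.ind
    simp only [← isoClass_tprod]
    exact isoClass_eq (Representation.TensorProduct.assoc _ _ _)
  one_mul x := by
    induction x using IsoClass.ind
    rw [← isoClass_trivial, ← isoClass_tprod]
    exact isoClass_eq (Representation.TensorProduct.lid _ _)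
  mul_one x := by
    induction x using IsoClass.ind
    rw [← isoClass_trivial, ← isoClass_tprod]
    exact isoClass_eq (Representation.TensorProduct.rid _ _)
  mul_comm x y := by
    induction x using IsoClass.ind
    induction y using IsoClass.ind
    simp only [← isoClass_tprod]
    exact isoClass_eq (Representation.TensorProduct.comm _ _)

theorem IsoClass.mul_add (x y z : IsoClass K G) : x * (y + z) = x * y + x * z := by
  induction x using IsoClass.ind
  induction y using IsoClass.ind
  induction z using IsoClass.ind
  simp only [← isoClass_tprod, ← isoClass_prod]
  exact isoClass_eq (tprodProdEquiv _ _ _)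

end IsoClass

/-! ### The representation ring -/

section RepRing

variable (K : Type u) (G : Type v) [Field K] [Group G]

/-- The free abelian group on the isomorphism classes of finite dimensional representations, with
the `ℤ`-bilinear product for which `[V] * [W] = [V ⊗ W]`. -/
abbrev FreeRepRing : Type (max u v) := MonoidAlgebra ℤ (IsoClass K G)

variable {K G} in
/-- The basis element of the free abelian group given by an isomorphism class. -/
abbrev freeClass (x : IsoClass K G) : FreeRepRing K G := MonoidAlgebra.single x 1

/-- The subgroup generated by the elements `[V] + [W] - [V ⊕ W]`. -/
def relSubgroup : AddSubgroup (FreeRepRing K G) :=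
  AddSubgroup.closure
    {r | ∃ x y : IsoClass K G, r = freeClass x + freeClass y - freeClass (x + y)}

/-- The subgroup generated by the elements `[V] + [W] - [V ⊕ W]` is an ideal. -/
def relIdeal : Ideal (FreeRepRing K G) where
  __ := relSubgroup K G
  smul_mem' c x hx := by
    change x ∈ relSubgroup K G at hx
    change c * x ∈ relSubgroup K G
    induction c using MonoidAlgebra.induction_linear with
    | zero => simp [zero_mem]
    | add a b ha hb => rw [add_mul]; exact add_mem ha hb
    | single a m =>
      have hs : (MonoidAlgebra.single a m : FreeRepRing K G) = m • freeClass a := by simp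
      rw [hs, smul_mul_assoc]
      refine zsmul_mem ?_ m
      unfold relSubgroup at hx ⊢
      induction hx using AddSubgroup.closure_induction with
      | mem x hx =>
        obtain ⟨y, z, rfl⟩ := hx
        refine AddSubgroup.subset_closure ⟨a * y, a * z, ?_⟩
        rw [← IsoClass.mul_add]
        simp [_root_.mul_add, mul_sub, MonoidAlgebra.single_mul_single]
      | zero => simp [zero_mem]
      | add x y _ _ hx hy => rw [_root_.mul_add]; exact add_mem hx hy
      | neg x _ hx => rw [mul_neg]; exact neg_mem hx

/-- The representation ring `R_K(G)`. -/
def RepRing : Type (max u v) := FreeRepRing K G ⧸ relIdeal K G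

instance : CommRing (RepRing K G) := inferInstanceAs (CommRing (FreeRepRing K G ⧸ relIdeal K G))

/-- The quotient map onto the representation ring. -/
def RepRing.mk : FreeRepRing K G →+* RepRing K G := Ideal.Quotient.mk (relIdeal K G)

variable {K G}

theorem RepRing.mk_surjective : Function.Surjective (RepRing.mk K G) :=
  Ideal.Quotient.mk_surjective

theorem RepRing.mk_eq_zero_iff {r : FreeRepRing K G} :
    RepRing.mk K G r = 0 ↔ r ∈ relSubgroup K G :=
  Ideal.Quotient.eq_zero_iff_mem

/-- The element of `R_K(G)` given by an isomorphism class. -/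
def repClass (x : IsoClass K G) : RepRing K G := RepRing.mk K G (freeClass x)

theorem repClass_add (x y : IsoClass K G) : repClass (x + y) = repClass x + repClass y := by
  symm
  rw [← sub_eq_zero, repClass, repClass, repClass, ← map_add, ← map_sub, RepRing.mk_eq_zero_iff]
  exact AddSubgroup.subset_closure ⟨x, y, rfl⟩

theorem repClass_mul (x y : IsoClass K G) : repClass (x * y) = repClass x * repClass y := by
  simp only [repClass, ← map_mul, MonoidAlgebra.single_mul_single, mul_one]

theorem RepRing.closure_eq_top :
    AddSubgroup.closure (Set.range (repClass : IsoClass K G → RepRing K G)) = ⊤ := by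
  refine eq_top_iff.2 fun x _ => ?_
  obtain ⟨x, rfl⟩ := RepRing.mk_surjective x
  induction x using MonoidAlgebra.induction_linear with
  | zero => simp [zero_mem]
  | add a b ha hb => rw [map_add]; exact add_mem (ha trivial) (hb trivial)
  | single a m =>
    have hs : (MonoidAlgebra.single a m : FreeRepRing K G) = m • freeClass a := by simp
    rw [hs, map_zsmul]
    exact zsmul_mem (AddSubgroup.subset_closure (Set.mem_range_self a)) m

end RepRing

/-! ### Induction -/

section Induction

variable {K : Type u} {G : Type v} [Field K] [Group G] (H : Subgroup G)
variable {V : Type*} [AddCommGroup V] [Module K V]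
variable {W : Type*} [AddCommGroup W] [Module K W]
variable {U : Type*} [AddCommGroup U] [Module K U]

open Representation

/-- The restricted representation `Res^G_H(V)`. -/
abbrev resRep (ρ : Representation K G V) : Representation K H V := ρ.comp H.subtype

/-- The induced representation `Ind_H^G(W)`. -/
abbrev indRep (σ : Representation K H W) : Representation K G (IndV H.subtype σ) :=
  Representation.ind H.subtype σ

/-- In the induced representation, `[h g ⊗ h w] = [g ⊗ w]` for `h` in `H`. -/
theorem indV_mk_mul (σ : Representation K H W) (h : H) (g : G) (w : W) :
    IndV.mk H.subtype σ (h * g) (σ h w) = IndV.mk H.subtype σ g w := by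
  have := Coinvariants.mk_self_apply (Representation.tprod ((leftRegular K G).comp H.subtype) σ) h
    (MonoidAlgebra.single g 1 ⊗ₜ w)
  simpa using this

/-- Induction on intertwining maps, as linear maps. -/
def indMap {σ : Representation K H W} {τ : Representation K H U} (f : σ.IntertwiningMap τ) :
    IndV H.subtype σ →ₗ[K] IndV H.subtype τ :=
  Coinvariants.map _ _ (IntertwiningMap.lTensor _ f)

theorem indMap_mk {σ : Representation K H W} {τ : Representation K H U}
    (f : σ.IntertwiningMap τ) (g : G) (w : W) :
    indMap H f (IndV.mk H.subtype σ g w) = IndV.mk H.subtype τ g (f w) := rfl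

/-- Representations induced from isomorphic representations are isomorphic. -/
def indEquiv {σ : Representation K H W} {τ : Representation K H U} (e : σ.Equiv τ) :
    (indRep H σ).Equiv (indRep H τ) :=
  .mk (LinearEquiv.ofLinearMap (indMap H e.toIntertwiningMap) (indMap H e.symm.toIntertwiningMap)
      (by
        refine IndV.hom_ext _ _ fun g => LinearMap.ext fun w => ?_
        change indMap H _ (indMap H _ (IndV.mk _ _ _ _)) = IndV.mk _ _ _ _
        rw [indMap_mk, indMap_mk]
        exact congrArg _ (e.apply_symm_apply w))
      (by
        refine IndV.hom_ext _ _ fun g => LinearMap.ext fun w => ?_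
        change indMap H _ (indMap H _ (IndV.mk _ _ _ _)) = IndV.mk _ _ _ _
        rw [indMap_mk, indMap_mk]
        exact congrArg _ (e.symm_apply_apply w)))
    fun g => by
      refine IndV.hom_ext _ _ fun h => LinearMap.ext fun w => ?_
      change indMap H _ (ind _ _ _ (IndV.mk _ _ _ _)) = ind _ _ _ (indMap H _ (IndV.mk _ _ _ _))
      simp only [ind_mk, indMap_mk]

/-- Induction commutes with direct sums. -/
def indProdEquiv (σ : Representation K H W) (τ : Representation K H U) :
    (indRep H (σ.prod τ)).Equiv ((indRep H σ).prod (indRep H τ)) :=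
  .mk (LinearEquiv.ofLinearMap
      ((indMap H (IntertwiningMap.fst K σ τ)).prod (indMap H (IntertwiningMap.snd K σ τ)))
      ((indMap H (IntertwiningMap.inl K σ τ)).coprod (indMap H (IntertwiningMap.inr K σ τ)))
      (by
        refine LinearMap.prod_ext (IndV.hom_ext _ _ fun g => LinearMap.ext fun w => ?_)
          (IndV.hom_ext _ _ fun g => LinearMap.ext fun w => ?_)
        · simp only [LinearMap.comp_apply, LinearMap.inl_apply, LinearMap.coprod_apply,
            map_zero, add_zero, LinearMap.id_apply]
          exact Prod.ext rfl (map_zero (IndV.mk H.subtype τ g))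
        · simp only [LinearMap.comp_apply, LinearMap.inr_apply, LinearMap.coprod_apply,
            map_zero, zero_add, LinearMap.id_apply]
          exact Prod.ext (map_zero (IndV.mk H.subtype σ g)) rfl)
      (by
        refine IndV.hom_ext _ _ fun g => LinearMap.ext fun w => ?_
        change IndV.mk H.subtype (σ.prod τ) g (w.1, 0) + IndV.mk H.subtype (σ.prod τ) g (0, w.2) =
          IndV.mk H.subtype (σ.prod τ) g w
        rw [← map_add, Prod.mk_add_mk, add_zero, zero_add]))
    fun g => by
      refine IndV.hom_ext _ _ fun h => LinearMap.ext fun w => ?_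
      change (indMap H _ (ind _ _ _ (IndV.mk _ _ _ _)), indMap H _ (ind _ _ _ (IndV.mk _ _ _ _)))
        = (ind _ _ _ (indMap H _ (IndV.mk _ _ _ _)), ind _ _ _ (indMap H _ (IndV.mk _ _ _ _)))
      simp only [ind_mk, indMap_mk]

/-- The linear map `V ⊗ Ind_H^G(W) → Ind_H^G(Res(V) ⊗ W)`, `v ⊗ [g ⊗ w] ↦ [g ⊗ (g v ⊗ w)]`. -/
def projFormulaHom (ρ : Representation K G V) (σ : Representation K H W) :
    V ⊗[K] IndV H.subtype σ →ₗ[K] IndV H.subtype ((resRep H ρ).tprod σ) :=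
  TensorProduct.lift <| LinearMap.flip <| Coinvariants.lift _
    (TensorProduct.lift <| (Finsupp.lift (W →ₗ[K] V →ₗ[K] _) K G fun g =>
        LinearMap.flip <| (TensorProduct.mk K V W).compr₂
          (IndV.mk H.subtype ((resRep H ρ).tprod σ) g) ∘ₗ ρ g) ∘ₗ
      (MonoidAlgebra.coeffLinearEquiv K).toLinearMap)
    fun h => by
      refine TensorProduct.ext <| MonoidAlgebra.lhom_ext' fun g => LinearMap.ext_ring <|
        LinearMap.ext fun w => LinearMap.ext fun v => ?_
      simpa using indV_mk_mul H ((resRep H ρ).tprod σ) h g (ρ g v ⊗ₜ w)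

theorem projFormulaHom_mk (ρ : Representation K G V) (σ : Representation K H W)
    (v : V) (g : G) (w : W) :
    projFormulaHom H ρ σ (v ⊗ₜ IndV.mk H.subtype σ g w) = IndV.mk H.subtype _ g (ρ g v ⊗ₜ w) := by
  simp [projFormulaHom]

/-- The linear map `Ind_H^G(Res(V) ⊗ W) → V ⊗ Ind_H^G(W)`,
`[g ⊗ (v ⊗ w)] ↦ g⁻¹ v ⊗ [g ⊗ w]`. -/
def projFormulaInv (ρ : Representation K G V) (σ : Representation K H W) :
    IndV H.subtype ((resRep H ρ).tprod σ) →ₗ[K] V ⊗[K] IndV H.subtype σ :=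
  Coinvariants.lift _
    (TensorProduct.lift <| (Finsupp.lift (V ⊗[K] W →ₗ[K] _) K G fun g =>
        TensorProduct.map (ρ g⁻¹) (IndV.mk H.subtype σ g)) ∘ₗ
      (MonoidAlgebra.coeffLinearEquiv K).toLinearMap)
    fun h => by
      refine TensorProduct.ext <| MonoidAlgebra.lhom_ext' fun g => LinearMap.ext_ring <|
        TensorProduct.ext' fun v w => ?_
      simpa using congrArg (ρ g⁻¹ v ⊗ₜ[K] ·) (indV_mk_mul H σ h g w)

theorem projFormulaInv_mk (ρ : Representation K G V) (σ : Representation K H W)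
    (v : V) (g : G) (w : W) :
    projFormulaInv H ρ σ (IndV.mk H.subtype _ g (v ⊗ₜ w)) = ρ g⁻¹ v ⊗ₜ IndV.mk H.subtype σ g w := by
  simp [projFormulaInv]

/-- `V ⊗ Ind_H^G(W) ≅ Ind_H^G(Res(V) ⊗ W)`. -/
def projFormula (ρ : Representation K G V) (σ : Representation K H W) :
    (ρ.tprod (indRep H σ)).Equiv (indRep H ((resRep H ρ).tprod σ)) :=
  .mk (LinearEquiv.ofLinearMap (projFormulaHom H ρ σ) (projFormulaInv H ρ σ)
      (by
        refine IndV.hom_ext _ _ fun g => TensorProduct.ext' fun v w => ?_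
        change projFormulaHom H ρ σ (projFormulaInv H ρ σ (IndV.mk _ _ _ _)) = IndV.mk _ _ _ _
        rw [projFormulaInv_mk, projFormulaHom_mk, Representation.self_inv_apply])
      (by
        refine TensorProduct.ext <| LinearMap.ext fun v =>
          IndV.hom_ext _ _ fun g => LinearMap.ext fun w => ?_
        change projFormulaInv H ρ σ (projFormulaHom H ρ σ (v ⊗ₜ IndV.mk _ _ _ _)) =
          v ⊗ₜ IndV.mk _ _ _ _
        rw [projFormulaHom_mk, projFormulaInv_mk, Representation.inv_self_apply]))
    fun g => by
      refine TensorProduct.ext <| LinearMap.ext fun v =>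
          IndV.hom_ext _ _ fun h => LinearMap.ext fun w => ?_
      change projFormulaHom H ρ σ (ρ g v ⊗ₜ ind _ _ _ (IndV.mk _ _ _ _)) =
        ind _ _ _ (projFormulaHom H ρ σ (v ⊗ₜ IndV.mk _ _ _ _))
      rw [ind_mk, projFormulaHom_mk, projFormulaHom_mk, ind_mk]
      simp [← Module.End.mul_apply, ← map_mul]

instance [Finite G] [Module.Finite K W] (σ : Representation K H W) :
    Module.Finite K (IndV H.subtype σ) := by
  have : Module.Finite K K[G] := Module.Finite.equiv (MonoidAlgebra.coeffLinearEquiv K).symm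
  infer_instance

variable [Finite G]

/-- `[W] ↦ [Ind_H^G(W)]` on isomorphism classes. -/
def indClass : IsoClass K H → IsoClass K G :=
  Quotient.lift (fun x => isoClass (indRep H x.2)) fun _ _ ⟨e⟩ => isoClass_eq (indEquiv H e)

theorem indClass_isoClass [Module.Finite K W] (σ : Representation K H W) :
    indClass H (isoClass σ) = isoClass (indRep H σ) :=
  isoClass_eq (indEquiv H (coordRepEquiv σ).symm)

theorem indClass_add (x y : IsoClass K H) : indClass H (x + y) = indClass H x + indClass H y := by
  induction x using IsoClass.ind
  induction y using IsoClass.ind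
  simp only [← isoClass_prod, indClass_isoClass]
  exact isoClass_eq (indProdEquiv H _ _)

variable (K) in
/-- The homomorphism of abelian groups `Ind_H^G : R_K(H) → R_K(G)` that sends the class of a
representation `W` to the class of `Ind_H^G(W)`. -/
def indHom : RepRing K H →+ RepRing K G :=
  QuotientAddGroup.lift (relSubgroup K H)
    ((Finsupp.liftAddHom fun x => zmultiplesHom _ (repClass (indClass H x))).comp
      MonoidAlgebra.coeffAddEquiv.toAddMonoidHom) <| by
    refine (AddSubgroup.closure_le _).2 ?_
    rintro _ ⟨x, y, rfl⟩
    change Finsupp.liftAddHom _ ((MonoidAlgebra.single x 1 : FreeRepRing K H).coeff +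
      (MonoidAlgebra.single y 1 : FreeRepRing K H).coeff -
      (MonoidAlgebra.single (x + y) 1 : FreeRepRing K H).coeff) = _
    simp only [map_add, map_sub]
    simp [indClass_add, repClass_add]

theorem indHom_repClass (x : IsoClass K H) : indHom K H (repClass x) = repClass (indClass H x) := by
  change Finsupp.liftAddHom _ (MonoidAlgebra.single x 1 : FreeRepRing K H).coeff = _
  simp

theorem repClass_mul_indHom_mem (x : IsoClass K G) (y : RepRing K H) :
    repClass x * indHom K H y ∈ (indHom K H).range := by
  have hy : y ∈ AddSubgroup.closure (Set.range (repClass : IsoClass K H → RepRing K H)) := by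
    rw [RepRing.closure_eq_top]; trivial
  induction hy using AddSubgroup.closure_induction with
  | mem y hy =>
    obtain ⟨y, rfl⟩ := hy
    induction x using IsoClass.ind with | _ m ρ =>
    induction y using IsoClass.ind with | _ n σ =>
    refine ⟨repClass (isoClass ((resRep H ρ).tprod σ)), ?_⟩
    simp only [indHom_repClass, indClass_isoClass, ← repClass_mul, ← isoClass_tprod]
    exact congrArg _ (isoClass_eq (projFormula H ρ σ).symm)
  | zero => simp [zero_mem]
  | add a b _ _ ha hb => rw [map_add, mul_add]; exact add_mem ha hb
  | neg a _ ha => rw [map_neg, mul_neg]; exact neg_mem ha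

variable (K) in
/-- The image `Ind_H^G(R_K(H))`, which is an ideal of `R_K(G)`. -/
def indIdeal : Ideal (RepRing K G) where
  __ := (indHom K H).range
  smul_mem' c x hx := by
    change x ∈ (indHom K H).range at hx
    change c * x ∈ (indHom K H).range
    obtain ⟨y, rfl⟩ := hx
    have hc : c ∈ AddSubgroup.closure (Set.range (repClass : IsoClass K G → RepRing K G)) := by
      rw [RepRing.closure_eq_top]; trivial
    induction hc using AddSubgroup.closure_induction with
    | mem c hc => obtain ⟨c, rfl⟩ := hc; exact repClass_mul_indHom_mem H c y
    | zero => simp [zero_mem]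
    | add a b _ _ ha hb => rw [add_mul]; exact add_mem ha hb
    | neg a _ ha => rw [neg_mul]; exact neg_mem ha

end Induction

end

/-! Write `n = |G|`, let `g` generate `G`, and let `χ` be a linear character with `χ g = ζ` a
primitive `n`-th root of unity. Every representation of `G` is a sum of linear characters and each
of these is a power of `χ`, so `X ↦ [χ]` maps `ℤ[X]` onto `R_K(G)`. It remains to see that the
preimage of the sum of the induced ideals is `(Φ_n)`.

The preimage lies in `(Φ_n)`: taking the character value at `g` kills every class induced from a
proper subgroup (`iSup_indIdeal_le_ker_char`) and sends `f([χ])` to `f(ζ)`, and `Φ_n` is the minimal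
polynomial of `ζ`.

Conversely, for a prime `p ∣ n` the class induced from the trivial representation of the subgroup of
index `p` is `∑_{j<p} [χ]^(j n/p)`, the value at `[χ]` of `(X^n - 1)/(X^(n/p) - 1) = Φ_n Q_p`
(`aeval_geom_sum_eq_indHom_one`). The cofactors `Q_p` generate the unit ideal of `ℤ[X]`, so `Φ_n` is
a combination of these polynomials (`cyclotomic_mem_span_geom_sum`). Indeed, at a common zero `x` of
the `Q_p` in a residue field, each `p` gives some `Φ_d(x) = 0` with `d ∣ n`, `d ∤ n/p`, `d ≠ n`. The
order of `x` determines `d` up to a power of the characteristic, and divisibility then gives a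
contradiction. -/

/-! ### Cyclotomic polynomials and geometric sums -/

open Polynomial in
/-- The sum `∑_{j<p} X^(j n/p)` is the product of the `d`-th cyclotomic polynomials over the
divisors `d` of `n` that do not divide `n/p`. -/
theorem geom_sum_X_pow_eq_prod_cyclotomic {n p : ℕ} (hn : n ≠ 0) (hp : p ∣ n) :
    ∑ j ∈ Finset.range p, (X ^ (n / p)) ^ j =
      ∏ d ∈ n.divisors \ (n / p).divisors, cyclotomic d ℤ := by
  have hpos : 0 < n / p := Nat.div_pos (Nat.le_of_dvd (Nat.pos_of_ne_zero hn) hp)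
    (Nat.pos_of_dvd_of_pos hp (Nat.pos_of_ne_zero hn))
  have h0 : (X ^ (n / p) - 1 : ℤ[X]) ≠ 0 := X_pow_sub_C_ne_zero hpos 1
  refine mul_left_cancel₀ h0 ?_
  rw [X_pow_sub_one_mul_prod_cyclotomic_eq_X_pow_sub_one_of_dvd ℤ (Nat.div_dvd_of_dvd hp) hn,
    mul_comm, geom_sum_mul, ← pow_mul, Nat.div_mul_cancel hp]

/-- Let `ℓ` be a prime factor of `n`. It is impossible that for each prime factor `p` of `n` some
proper divisor of `n` of the form `ℓ ^ a * o` does not divide `n / p`. -/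
theorem not_forall_prime_pow_mul_dvd {n ℓ o : ℕ} (hℓ : ℓ.Prime) (hℓn : ℓ ∣ n)
    (h : ∀ p, p.Prime → p ∣ n → ∃ a, ℓ ^ a * o ∣ n ∧ ¬ ℓ ^ a * o ∣ n / p ∧ ℓ ^ a * o ≠ n) :
    False := by
  -- The choice `p = ℓ` makes `a` the largest exponent with `ℓ ^ a * o ∣ n`. A prime `q` dividing
  -- the cofactor, which is not `1`, then gives `b`: if `b ≤ a`, then `ℓ ^ b * o` divides `n / q`,
  -- and `b > a` contradicts maximality.
  obtain ⟨a, han, haℓ, hne⟩ := h ℓ hℓ hℓn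
  obtain ⟨q, hq, hqd⟩ := Nat.exists_prime_and_dvd (n := n / (ℓ ^ a * o)) fun h1 =>
    hne (Nat.eq_of_dvd_of_div_eq_one han h1)
  have hqn : ℓ ^ a * o * q ∣ n := Nat.mul_dvd_of_dvd_div han hqd
  obtain ⟨b, hbn, hbq, -⟩ := h q hq ((dvd_mul_left _ _).trans hqn)
  rcases le_or_gt b a with hba | hab
  · refine hbq ((mul_dvd_mul_right (pow_dvd_pow ℓ hba) o).trans ?_)
    exact Nat.dvd_div_of_mul_dvd (by rwa [mul_comm])
  · refine haℓ (Nat.dvd_div_of_mul_dvd ((Dvd.dvd.trans ?_) hbn))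
    rw [← mul_assoc, ← pow_succ']
    exact mul_dvd_mul_right (pow_dvd_pow ℓ hab) o

open Polynomial in
/-- No point of a field is, for each prime factor `p` of `n`, a root of some cyclotomic polynomial
`Φ_d` with `d ∣ n`, `d ∤ n / p` and `d ≠ n`. -/
theorem not_forall_prime_isRoot_cyclotomic {F : Type*} [Field F] {n : ℕ} (hn : 1 < n) (x : F)
    (h : ∀ p, p.Prime → p ∣ n → ∃ d, d ∣ n ∧ ¬ d ∣ n / p ∧ d ≠ n ∧ (cyclotomic d F).IsRoot x) :
    False := by
  have hn0 : n ≠ 0 := by omega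
  -- If the characteristic `ℓ` of `F` divides `n`, the roots of `Φ_(ℓ^a m)` with `ℓ ∤ m` are the
  -- primitive `m`-th roots of unity, so `m = orderOf x` for every `p` and only `a` varies.
  -- Otherwise `d = orderOf x` for every `p`, and any prime `ℓ ∣ n` serves, with `a = 0`.
  by_cases hF : (n : F) = 0
  · obtain ⟨ℓ, hchar⟩ := CharP.exists F
    have hℓn : ℓ ∣ n := (CharP.cast_eq_zero_iff F ℓ n).1 hF
    have hℓ : ℓ.Prime := (CharP.char_is_prime_or_zero F ℓ).resolve_right fun h0 =>
      hn0 (Nat.eq_zero_of_zero_dvd (h0 ▸ hℓn))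
    have : Fact ℓ.Prime := ⟨hℓ⟩
    refine not_forall_prime_pow_mul_dvd (o := orderOf x) hℓ hℓn fun p hp hpn => ?_
    obtain ⟨d, hdn, hdp, hne, hroot⟩ := h p hp hpn
    obtain ⟨a, m, hm, rfl⟩ := Nat.exists_eq_pow_mul_and_not_dvd
      (ne_zero_of_dvd_ne_zero hn0 hdn) ℓ hℓ.ne_one
    have : NeZero (m : F) := ⟨fun h0 => hm ((CharP.cast_eq_zero_iff F ℓ m).1 h0)⟩
    rw [isRoot_cyclotomic_prime_pow_mul_iff_of_charP] at hroot
    rw [← hroot.eq_orderOf]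
    exact ⟨a, hdn, hdp, hne⟩
  · obtain ⟨ℓ, hℓ, hℓn⟩ := Nat.exists_prime_and_dvd hn.ne'
    refine not_forall_prime_pow_mul_dvd (o := orderOf x) hℓ hℓn fun p hp hpn => ?_
    obtain ⟨d, hdn, hdp, hne, hroot⟩ := h p hp hpn
    have : NeZero (d : F) := ⟨fun h0 => hF (by
      obtain ⟨c, rfl⟩ := hdn
      rw [Nat.cast_mul, h0, zero_mul])⟩
    rw [isRoot_cyclotomic_iff] at hroot
    refine ⟨0, ?_⟩
    rw [pow_zero, one_mul, ← hroot.eq_orderOf]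
    exact ⟨hdn, hdp, hne⟩

open Polynomial in
/-- For `n > 1`, the cyclotomic polynomial `Φ_n` is a `ℤ[X]`-linear combination of the polynomials
`∑_{j<p} X^(j n/p)`, for `p` a prime factor of `n`. -/
theorem cyclotomic_mem_span_geom_sum {n : ℕ} (hn : 1 < n) :
    cyclotomic n ℤ ∈ Ideal.span {f : ℤ[X] | ∃ p, p.Prime ∧ p ∣ n ∧
      f = ∑ j ∈ Finset.range p, (X ^ (n / p)) ^ j} := by
  have hn0 : n ≠ 0 := by omega
  let Q (p : ℕ) : ℤ[X] := ∏ d ∈ (n.divisors \ (n / p).divisors).erase n, cyclotomic d ℤ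
  have hQ (p : ℕ) (hp : p.Prime) (hpn : p ∣ n) :
      cyclotomic n ℤ * Q p = ∑ j ∈ Finset.range p, (X ^ (n / p)) ^ j := by
    rw [geom_sum_X_pow_eq_prod_cyclotomic hn0 hpn]
    refine Finset.mul_prod_erase _ (fun d => cyclotomic d ℤ) ?_
    have hlt : n / p < n := Nat.div_lt_self (by omega) hp.one_lt
    have hpos : 0 < n / p := Nat.div_pos (Nat.le_of_dvd (by omega) hpn) hp.pos
    simp only [Finset.mem_sdiff, Nat.mem_divisors]
    exact ⟨⟨dvd_rfl, hn0⟩, fun h => hlt.not_ge (Nat.le_of_dvd hpos h.1)⟩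
  have htop : Ideal.span {f : ℤ[X] | ∃ p, p.Prime ∧ p ∣ n ∧ f = Q p} = ⊤ := by
    by_contra hne
    obtain ⟨M, hM, hle⟩ := Ideal.exists_le_maximal _ hne
    let _ : Field (ℤ[X] ⧸ M) := Ideal.Quotient.field M
    refine not_forall_prime_isRoot_cyclotomic hn (Ideal.Quotient.mk M X) fun p hp hpn => ?_
    have hmem : Q p ∈ M := hle (Ideal.subset_span ⟨p, hp, hpn, rfl⟩)
    obtain ⟨d, hd, hdM⟩ := (hM.isPrime.prod_mem_iff).1 hmem
    simp only [Finset.mem_erase, Finset.mem_sdiff, Nat.mem_divisors] at hd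
    refine ⟨d, hd.2.1.1, fun h => hd.2.2 ⟨h, ?_⟩, hd.1, ?_⟩
    · exact (Nat.div_pos (Nat.le_of_dvd (by omega) hpn) hp.pos).ne'
    · have h1 := Ideal.Quotient.eq_zero_iff_mem.2 hdM
      rw [IsRoot.def, ← map_cyclotomic_int, eval_map, ← h1]
      -- The class of `Φ_d` modulo `M` is the value of `Φ_d` at the class of `X`.
      nth_rewrite 2 [← eval₂_C_X (p := cyclotomic d ℤ)]
      rw [hom_eval₂]
      congr 1
  -- Multiplying the unit ideal `(Q_p)_p` by `Φ_n` gives the ideal of the geometric sums `Φ_n Q_p`.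
  have h1 : cyclotomic n ℤ ∈ Ideal.span {cyclotomic n ℤ} *
      Ideal.span {f : ℤ[X] | ∃ p, p.Prime ∧ p ∣ n ∧ f = Q p} := by
    rw [htop, Ideal.mul_top]
    exact Ideal.mem_span_singleton_self _
  rw [Ideal.span_mul_span'] at h1
  refine Ideal.span_mono ?_ h1
  rintro _ ⟨_, rfl, _, ⟨p, hp, hpn, rfl⟩, rfl⟩
  exact ⟨p, hp, hpn, hQ p hp hpn⟩

noncomputable section

/-! ### Characters as ring homomorphisms on the representation ring -/

section Character

variable {K : Type u} {G : Type v} [Field K] [Group G]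
variable {V : Type*} [AddCommGroup V] [Module K V]
variable {W : Type*} [AddCommGroup W] [Module K W]

theorem trace_eq_of_equiv {ρ : Representation K G V} {σ : Representation K G W} (e : ρ.Equiv σ)
    (x : G) : LinearMap.trace K V (ρ x) = LinearMap.trace K W (σ x) := by
  rw [← e.conj_apply_self x, LinearMap.trace_conj']

/-- The value at `x` of the character of an isomorphism class of representations. -/
def IsoClass.char (x : G) : IsoClass K G → K :=
  Quotient.lift (fun y => LinearMap.trace K _ (y.2 x)) fun _ _ ⟨e⟩ => trace_eq_of_equiv e x

theorem IsoClass.char_isoClass [Module.Finite K V] (x : G) (ρ : Representation K G V) :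
    IsoClass.char x (isoClass ρ) = LinearMap.trace K V (ρ x) :=
  (trace_eq_of_equiv (coordRepEquiv ρ) x).symm

theorem IsoClass.char_add (x : G) (a b : IsoClass K G) :
    IsoClass.char x (a + b) = IsoClass.char x a + IsoClass.char x b := by
  induction a using IsoClass.ind
  induction b using IsoClass.ind
  rw [← isoClass_prod]
  simp only [IsoClass.char_isoClass]
  exact LinearMap.trace_prodMap' _ _

/-- The character value at `x`, as a monoid homomorphism. -/
def IsoClass.charHom (x : G) : IsoClass K G →* K where
  toFun := IsoClass.char x
  map_one' := by
    rw [← isoClass_trivial, IsoClass.char_isoClass]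
    simp [Representation.trivial]
  map_mul' a b := by
    induction a using IsoClass.ind
    induction b using IsoClass.ind
    rw [← isoClass_tprod]
    simp only [IsoClass.char_isoClass]
    exact LinearMap.trace_tensorProduct' _ _

/-- The ring homomorphism `R_K(G) → K` that sends the class of a representation to the value at `x`
of its character. -/
def RepRing.char (x : G) : RepRing K G →+* K :=
  Ideal.Quotient.lift (relIdeal K G)
    (MonoidAlgebra.lift ℤ K (IsoClass K G) (IsoClass.charHom x)).toRingHom fun a ha => by
      change a ∈ relSubgroup K G at ha
      unfold relSubgroup at ha
      induction ha using AddSubgroup.closure_induction with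
      | mem a ha =>
        obtain ⟨y, z, rfl⟩ := ha
        have h := IsoClass.char_add x y z
        simp [IsoClass.charHom, h]
      | zero => exact map_zero _
      | add a b _ _ ha hb => rw [map_add, ha, hb, add_zero]
      | neg a _ ha => rw [map_neg, ha, neg_zero]

theorem RepRing.char_repClass (x : G) (y : IsoClass K G) :
    RepRing.char x (repClass y) = IsoClass.char x y := by
  change MonoidAlgebra.lift ℤ K (IsoClass K G) (IsoClass.charHom x) (freeClass y) = _
  rw [MonoidAlgebra.lift_single, one_smul]
  rfl

end Character

/-! ### Linear characters -/

section LinearCharacter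

variable {K : Type u} {G : Type v} [Field K] [Group G]

/-- The one dimensional representation on `K` given by a homomorphism `G → K`. -/
def linearRep (θ : G →* K) : Representation K G K where
  toFun x := θ x • LinearMap.id
  map_one' := by rw [map_one, one_smul]; rfl
  map_mul' x y := by
    rw [map_mul]
    ext
    simp [mul_comm]

theorem linearRep_apply (θ : G →* K) (x : G) (a : K) : linearRep θ x a = θ x * a := rfl

theorem linearRep_one : linearRep (1 : G →* K) = Representation.trivial K G K := by
  ext x
  simp [linearRep]

/-- The tensor product of the representations given by `θ` and `η` is the one given by `θ * η`. -/
def linearRepTprodEquiv (θ η : G →* K) :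
    ((linearRep θ).tprod (linearRep η)).Equiv (linearRep (θ * η)) :=
  .mk (TensorProduct.lid K K) fun x => by
    ext
    simp [linearRep_apply]

/-- The class in `R_K(G)` of the one dimensional representation given by `θ`. -/
def linearClass : (G →* K) →* RepRing K G where
  toFun θ := repClass (isoClass (linearRep θ))
  map_one' := by rw [linearRep_one, isoClass_trivial]; rfl
  map_mul' θ η := by
    rw [← repClass_mul, ← isoClass_tprod]
    exact congrArg repClass (isoClass_eq (linearRepTprodEquiv θ η)).symm

theorem char_linearClass (θ : G →* K) (x : G) : RepRing.char x (linearClass θ) = θ x := by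
  change RepRing.char x (repClass (isoClass (linearRep θ))) = _
  rw [RepRing.char_repClass, IsoClass.char_isoClass]
  simp [linearRep]

end LinearCharacter

/-! ### Vanishing of induced characters -/

section InducedCharacter

variable {K : Type u} {G : Type v} [Field K] [Group G] [Finite G] (H : Subgroup G)

/-- A one dimensional representation that is trivial on `H` does not change, by its product, a
class induced from `H`. -/
theorem linearClass_mul_indHom {θ : G →* K} (hθ : ∀ h ∈ H, θ h = 1) (y : RepRing K H) :
    linearClass θ * indHom K H y = indHom K H y := by
  have hy : y ∈ AddSubgroup.closure (Set.range (repClass : IsoClass K H → RepRing K H)) := by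
    rw [RepRing.closure_eq_top]; trivial
  induction hy using AddSubgroup.closure_induction with
  | mem y hy =>
    obtain ⟨y, rfl⟩ := hy
    induction y using IsoClass.ind with | _ n σ =>
    change repClass (isoClass (linearRep θ)) * _ = _
    simp only [indHom_repClass, indClass_isoClass, ← repClass_mul, ← isoClass_tprod]
    -- By the projection formula, `θ ⊗ Ind σ ≅ Ind (Res θ ⊗ σ)`, and `Res θ` is trivial.
    have hres : resRep H (linearRep θ) = Representation.trivial K H K := by
      ext h
      simp [linearRep, hθ h h.2]
    refine congrArg _ (isoClass_eq ((projFormula H (linearRep θ) σ).trans (indEquiv H ?_)))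
    rw [hres]
    exact Representation.TensorProduct.lid _ _
  | zero => simp
  | add a b _ _ ha hb => rw [map_add, mul_add, ha, hb]
  | neg a _ ha => rw [map_neg, mul_neg, ha]

/-- Induced characters vanish at `x` if some linear character is trivial on `H` and not at `x`. -/
theorem char_indHom_eq_zero {θ : G →* K} (hθ : ∀ h ∈ H, θ h = 1) {x : G} (hx : θ x ≠ 1)
    (y : RepRing K H) : RepRing.char x (indHom K H y) = 0 := by
  have h := congrArg (RepRing.char x) (linearClass_mul_indHom H hθ y)
  rw [map_mul, char_linearClass] at h
  exact by_contra fun h0 => hx ((mul_eq_right₀ h0).1 h)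

end InducedCharacter

/-! ### The representation induced from the trivial one -/

section InducedTrivial

open Representation

variable {K : Type u} {G : Type v} [Field K] [Group G] (H : Subgroup G)

theorem indV_trivial_mk_mul (h : H) (g : G) (w : K) :
    IndV.mk H.subtype (Representation.trivial K H K) (h * g) w =
      IndV.mk H.subtype (Representation.trivial K H K) g w :=
  indV_mk_mul H (Representation.trivial K H K) h g w

/-- The space of `Ind_H^G(K)` has a basis indexed by the cosets of `H`. -/
def indVTrivialEquiv :
    IndV H.subtype (Representation.trivial K H K) ≃ₗ[K] (G ⧸ H →₀ K) :=
  LinearEquiv.ofLinearMap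
    (Coinvariants.lift _
      (TensorProduct.lift <| (Finsupp.lift (K →ₗ[K] (G ⧸ H →₀ K)) K G fun g =>
          -- Coinvariants identify `h * g` with `g`, which gives right cosets `H g`; inversion turns
          -- them into the left cosets of `G ⧸ H`.
          Finsupp.lsingle (QuotientGroup.mk g⁻¹ : G ⧸ H)) ∘ₗ
        (MonoidAlgebra.coeffLinearEquiv K).toLinearMap)
      fun h => by
        refine TensorProduct.ext <| MonoidAlgebra.lhom_ext' fun g => LinearMap.ext_ring <|
          LinearMap.ext_ring ?_
        simp)
    (Finsupp.lift _ K (G ⧸ H) fun q => IndV.mk H.subtype (Representation.trivial K H K) q.out⁻¹ 1)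
    (by
      refine Finsupp.lhom_ext' fun q => LinearMap.ext_ring ?_
      simp)
    (by
      refine IndV.hom_ext _ _ fun g => LinearMap.ext_ring ?_
      obtain ⟨h, hh⟩ := QuotientGroup.mk_out_eq_mul H g⁻¹
      have := indV_trivial_mk_mul H h⁻¹ g (1 : K)
      simpa [hh] using this)

theorem finrank_indV_trivial [Finite G] :
    Module.finrank K (IndV H.subtype (Representation.trivial K H K)) = H.index := by
  have := Fintype.ofFinite (G ⧸ H)
  rw [(indVTrivialEquiv H).finrank_eq, Module.finrank_finsupp_self, Subgroup.index,
    Nat.card_eq_fintype_card]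

end InducedTrivial

/-- Since `x` is central and lies in `H`, it acts as the identity: `[g ⊗ w] ↦ [g x⁻¹ ⊗ w] = [x⁻¹ g ⊗
w] = [g ⊗ w]`. The trace is therefore the dimension. -/
theorem char_indHom_one_of_mem {K : Type u} {G : Type v} [Field K] [Group G] [Finite G]
    (H : Subgroup G) {x : G} (hx : x ∈ H) (hc : x ∈ Subgroup.center G) :
    RepRing.char x (indHom K H 1) = H.index := by
  have h1 : (1 : RepRing K H) = repClass (isoClass (Representation.trivial K H K)) := rfl
  rw [h1, indHom_repClass, indClass_isoClass, RepRing.char_repClass, IsoClass.char_isoClass,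
    ← finrank_indV_trivial (K := K) H, ← LinearMap.trace_id]
  congr 1
  refine Representation.IndV.hom_ext _ _ fun g => LinearMap.ext fun w => ?_
  change indRep H _ x (Representation.IndV.mk _ _ _ _) = Representation.IndV.mk _ _ _ _
  rw [Representation.ind_mk, Subgroup.mem_center_iff.1 (inv_mem hc) g]
  exact indV_trivial_mk_mul H (⟨x, hx⟩⁻¹ : H) g w

/-! ### Decomposition into linear characters -/

section Semisimple

variable {K : Type u} {G : Type v} [Field K] [Group G]
variable {V : Type w} [AddCommGroup V] [Module K V]

/-- A one dimensional representation is given by a linear character. -/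
theorem exists_equiv_linearRep (ρ : Representation K G V) (h : Module.finrank K V = 1) :
    ∃ θ : G →* K, Nonempty (ρ.Equiv (linearRep θ)) := by
  have : Module.Finite K V := Module.finite_of_finrank_eq_succ h
  -- In dimension one the determinant of a scalar map is that scalar.
  refine ⟨LinearMap.det.comp ρ, ⟨.mk (LinearEquiv.ofFinrankEq V K (by simp [h])) fun x => ?_⟩⟩
  obtain ⟨c, hc, -⟩ := LinearMap.existsUnique_eq_smul_id_of_finrank_eq_one h (ρ x)
  ext v
  simp [linearRep_apply, hc, h]

/-- Complementary subrepresentations decompose a representation. -/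
def prodSubrepresentationEquiv (ρ : Representation K G V) {p q : Submodule K V}
    (hp : ∀ x, p ≤ p.comap (ρ x)) (hq : ∀ x, q ≤ q.comap (ρ x)) (hpq : IsCompl p q) :
    ((ρ.subrepresentation p hp).prod (ρ.subrepresentation q hq)).Equiv ρ :=
  .mk (Submodule.prodEquivOfIsCompl p q hpq) fun x => by
    ext v <;> simp [Representation.subrepresentation]

/-- Here `V ⊕ V ≅ V`, so `[V] + [V] = [V]`. -/
theorem repClass_eq_zero_of_subsingleton [Subsingleton V] [Module.Finite K V]
    (ρ : Representation K G V) : repClass (isoClass ρ) = 0 := by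
  have e : (ρ.prod ρ).Equiv ρ := .mk (LinearEquiv.ofSubsingleton _ _) fun x => by
    ext v <;> exact Subsingleton.elim _ _
  have h := repClass_add (isoClass ρ) (isoClass ρ)
  rw [← isoClass_prod, isoClass_eq e] at h
  exact left_eq_add.1 h

/-- The polynomial `X^n - 1` annihilates `f` and is separable in characteristic zero, hence
squarefree. -/
theorem isSemisimple_of_pow_eq_one [CharZero K] [Module.Finite K V] {f : Module.End K V} {n : ℕ}
    (hn : n ≠ 0) (hf : f ^ n = 1) : f.IsSemisimple := by
  refine Module.End.isSemisimple_of_squarefree_aeval_eq_zero (p := (Polynomial.X ^ n - 1)) ?_ ?_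
  · exact (Polynomial.X_pow_sub_one_separable_iff.2 (Nat.cast_ne_zero.2 hn)).squarefree
  · simp [hf]

/-- Over an algebraically closed field of characteristic zero, the class of a representation of a
finite cyclic group is a sum of classes of linear characters. -/
theorem repClass_mem_closure_linearClass [IsAlgClosed K] [CharZero K] [Finite G] {g : G}
    (hg : ∀ x, x ∈ Submonoid.powers g) {m : ℕ} [Module.Finite K V] (ρ : Representation K G V)
    (hm : Module.finrank K V = m) :
    repClass (isoClass ρ) ∈
      AddSubgroup.closure (Set.range (linearClass : (G →* K) →* RepRing K G)) := by
  induction m generalizing V with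
  | zero =>
    have := Module.finrank_zero_iff.1 hm
    rw [repClass_eq_zero_of_subsingleton]
    exact zero_mem _
  | succ m ih =>
    have : Nontrivial V := Module.nontrivial_of_finrank_pos (R := K) (by omega)
    -- Every element is a natural power of `g`, so invariance under `ρ g` alone suffices. An
    -- eigenline of `ρ g` is then a subrepresentation, and semisimplicity of `ρ g` gives a
    -- complementary one, of dimension `m`.
    have hinv {p : Submodule K V} (hp : p ∈ Module.End.invtSubmodule (ρ g)) (x : G) :
        p ≤ p.comap (ρ x) := by
      obtain ⟨k, rfl⟩ := hg x
      intro v hv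
      change ρ (g ^ k) v ∈ p
      induction k with
      | zero => simpa using hv
      | succ k ih =>
        rw [pow_succ', map_mul, Module.End.mul_apply]
        exact (Module.End.mem_invtSubmodule _).1 hp ih
    obtain ⟨μ, hμ⟩ := Module.End.exists_eigenvalue (ρ g)
    obtain ⟨v, hv⟩ := hμ.exists_hasEigenvector
    have hp : (K ∙ v) ∈ Module.End.invtSubmodule (ρ g) := by
      rw [Module.End.mem_invtSubmodule, Submodule.span_singleton_le_iff_mem, Submodule.mem_comap,
        hv.apply_eq_smul]
      exact Submodule.smul_mem _ _ (Submodule.mem_span_singleton_self v)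
    have hss : Module.End.IsSemisimple (ρ g) :=
      isSemisimple_of_pow_eq_one (Nat.card_pos (α := G)).ne'
        (by rw [← map_pow, pow_card_eq_one', map_one])
    obtain ⟨q, hq, hpq⟩ := Module.End.isSemisimple_iff.1 hss _ hp
    have h1 : Module.finrank K (K ∙ v) = 1 := finrank_span_singleton hv.2
    have hadd := Submodule.finrank_add_eq_of_isCompl hpq
    rw [← isoClass_eq (prodSubrepresentationEquiv ρ (hinv hp) (hinv hq) hpq), isoClass_prod,
      repClass_add]
    obtain ⟨θ, ⟨e⟩⟩ := exists_equiv_linearRep (ρ.subrepresentation (K ∙ v) (hinv hp)) h1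
    refine add_mem (AddSubgroup.subset_closure ⟨θ, ?_⟩) (ih _ (by omega))
    exact congrArg repClass (isoClass_eq e.symm)

end Semisimple

/-! ### The representation ring of a cyclic group -/

section Cyclic

open Polynomial

variable {K : Type u} {G : Type v} [Field K] [Group G]
variable {g : G} {χ : G →* K}

theorem linearClass_pow_card (χ : G →* K) : linearClass χ ^ Nat.card G = 1 := by
  rw [← map_pow, ← map_one linearClass]
  congr 1
  ext x
  rw [MonoidHom.pow_apply, ← map_pow, pow_card_eq_one', map_one, MonoidHom.one_apply]

theorem char_aeval_linearClass (χ : G →* K) (x : G) (f : ℤ[X]) :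
    RepRing.char x (aeval (linearClass χ) f) = aeval (χ x) f := by
  rw [← char_linearClass χ x]
  exact (aeval_algHom_apply (RepRing.char (K := K) x).toIntAlgHom (linearClass χ) f).symm

variable [Finite G]

/-- Linear characters of a cyclic group are powers of a faithful one. -/
theorem exists_eq_pow_of_isPrimitiveRoot (hg : ∀ x, x ∈ Submonoid.powers g)
    (hχ : IsPrimitiveRoot (χ g) (Nat.card G)) (θ : G →* K) : ∃ k : ℕ, θ = χ ^ k := by
  have : NeZero (Nat.card G) := ⟨Nat.card_pos.ne'⟩
  obtain ⟨k, -, hk⟩ := hχ.eq_pow_of_pow_eq_one (ξ := θ g)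
    (by rw [← map_pow, pow_card_eq_one', map_one])
  refine ⟨k, MonoidHom.ext fun x => ?_⟩
  obtain ⟨j, rfl⟩ := hg x
  simp only [map_pow, MonoidHom.pow_apply, hk]

/-- Linear characters generate `R_K(G)` additively, and each is a power of `χ`. -/
theorem aeval_linearClass_surjective [IsAlgClosed K] [CharZero K]
    (hg : ∀ x, x ∈ Submonoid.powers g) (hχ : IsPrimitiveRoot (χ g) (Nat.card G)) :
    Function.Surjective (aeval (R := ℤ) (linearClass χ)) := by
  intro r
  have hr : r ∈ AddSubgroup.closure (Set.range (repClass : IsoClass K G → RepRing K G)) := by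
    rw [RepRing.closure_eq_top]; trivial
  refine (AddSubgroup.closure_le
    (aeval (R := ℤ) (linearClass χ)).range.toSubring.toAddSubgroup).2 ?_ hr
  rintro _ ⟨y, rfl⟩
  induction y using IsoClass.ind with | _ m ρ =>
  refine (AddSubgroup.closure_le _).2 ?_ (repClass_mem_closure_linearClass hg ρ rfl)
  rintro _ ⟨θ, rfl⟩
  obtain ⟨k, rfl⟩ := exists_eq_pow_of_isPrimitiveRoot hg hχ θ
  exact ⟨X ^ k, by simp⟩

/-- Over `K`, `X^n - 1` is a product of pairwise coprime factors `X - ζ^k`, each dividing `f`.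
Divisibility descends to `ℤ` because `X^n - 1` is monic. -/
theorem X_pow_sub_one_dvd_of_forall_aeval_eq_zero [CharZero K] {ζ : K} {n : ℕ} (hn : 0 < n)
    (hζ : IsPrimitiveRoot ζ n) {f : ℤ[X]} (hf : ∀ k : ℕ, aeval (ζ ^ k) f = 0) :
    X ^ n - 1 ∣ f := by
  have hm : (X ^ n - 1 : ℤ[X]).Monic := monic_X_pow_sub_C 1 hn.ne'
  rw [← map_dvd_map (Int.castRingHom K) Int.cast_injective hm]
  have hX : (X ^ n - 1 : ℤ[X]).map (Int.castRingHom K) = X ^ n - 1 := by simp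
  rw [hX, X_pow_sub_one_eq_prod hn hζ]
  refine Finset.prod_dvd_of_coprime
    (fun a _ b _ hab => pairwise_coprime_X_sub_C Function.injective_id hab) fun μ hμ => ?_
  have : NeZero n := ⟨hn.ne'⟩
  obtain ⟨k, -, rfl⟩ := hζ.eq_pow_of_pow_eq_one ((mem_nthRootsFinset hn 1).1 hμ)
  rw [dvd_iff_isRoot, IsRoot.def, eval_map]
  exact hf k

/-- An integral polynomial in `[χ]` is determined by its values at the roots of unity. -/
theorem aeval_linearClass_eq [CharZero K] (hχ : IsPrimitiveRoot (χ g) (Nat.card G)) {f₁ f₂ : ℤ[X]}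
    (hf : ∀ k : ℕ, aeval (χ g ^ k) f₁ = aeval (χ g ^ k) f₂) :
    aeval (linearClass χ) f₁ = aeval (linearClass χ) f₂ := by
  obtain ⟨q, hq⟩ := X_pow_sub_one_dvd_of_forall_aeval_eq_zero Nat.card_pos hχ
    (f := f₁ - f₂) fun k => by rw [map_sub, hf, sub_self]
  rw [← sub_eq_zero, ← map_sub, hq, map_mul, map_sub, map_pow, aeval_X, linearClass_pow_card]
  simp

theorem index_zpowers_pow (hg : ∀ x, x ∈ Submonoid.powers g) {p : ℕ} (hp : p ∣ Nat.card G) :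
    (Subgroup.zpowers (g ^ p)).index = p := by
  have ho : orderOf g = Nat.card G :=
    orderOf_eq_card_of_forall_mem_zpowers fun x => mem_powers_iff_mem_zpowers.1 (hg x)
  have hp0 : p ≠ 0 := ne_zero_of_dvd_ne_zero Nat.card_pos.ne' hp
  have h := (Subgroup.zpowers (g ^ p)).card_mul_index
  rw [Nat.card_zpowers, orderOf_pow_of_dvd hp0 (ho ▸ hp), ho] at h
  have hd := Nat.div_mul_cancel hp
  have hpos : 0 < Nat.card G / p :=
    Nat.pos_of_ne_zero fun h0 => Nat.card_pos.ne' (by rw [← hd, h0, zero_mul])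
  exact Nat.eq_of_mul_eq_mul_left hpos (h.trans hd.symm)

/-- `∑_{j<p} [χ]^(j n/p)` is the class induced from the trivial representation of the subgroup of
index `p`. -/
theorem aeval_geom_sum_eq_indHom_one [IsAlgClosed K] [CharZero K]
    (hg : ∀ x, x ∈ Submonoid.powers g) (hχ : IsPrimitiveRoot (χ g) (Nat.card G)) {p : ℕ}
    (hp : p ∣ Nat.card G) :
    aeval (linearClass χ) (∑ j ∈ Finset.range p, (X ^ (Nat.card G / p)) ^ j : ℤ[X]) =
      indHom K (Subgroup.zpowers (g ^ p)) 1 := by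
  -- Once the induced class is written as a polynomial in `[χ]`, it is enough to compare character
  -- values at the `g ^ k`; no explicit decomposition of the induced representation is needed.
  obtain ⟨f, hf⟩ := aeval_linearClass_surjective hg hχ (indHom K (Subgroup.zpowers (g ^ p)) 1)
  rw [← hf]
  have hd := Nat.div_mul_cancel hp
  have hpos : 0 < Nat.card G / p :=
    Nat.pos_of_ne_zero fun h0 => Nat.card_pos.ne' (by rw [← hd, h0, zero_mul])
  refine aeval_linearClass_eq hχ fun k => ?_
  rw [← map_pow χ g k, ← char_aeval_linearClass χ (g ^ k) f, hf]
  simp only [map_sum, map_pow, aeval_X]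
  -- If `p ∣ k`, then `g ^ k` lies in the subgroup and both sides equal its index `p`. Otherwise
  -- both vanish: the left side is a geometric sum with ratio `ζ^(k n/p) ≠ 1` whose `p`-th power is
  -- `1`, and `χ^(n/p)` is trivial on the subgroup but not at `g ^ k`.
  by_cases hk : p ∣ k
  · obtain ⟨j, rfl⟩ := hk
    rw [char_indHom_one_of_mem, index_zpowers_pow hg hp]
    · rw [← pow_mul (χ g), mul_comm, ← mul_assoc, hd, pow_mul, hχ.pow_eq_one]
      simp
    · rw [pow_mul]
      exact pow_mem (Subgroup.mem_zpowers _) j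
    · refine Subgroup.mem_center_iff.2 fun y => ?_
      obtain ⟨i, rfl⟩ := hg y
      exact (Commute.pow_pow (Commute.refl g) _ _).eq
  · have hne : (χ g ^ k) ^ (Nat.card G / p) ≠ 1 := by
      rw [← pow_mul, Ne, hχ.pow_eq_one_iff_dvd, mul_comm]
      nth_rewrite 1 [← hd]
      rwa [Nat.mul_dvd_mul_iff_left hpos]
    rw [char_indHom_eq_zero _ (θ := χ ^ (Nat.card G / p))]
    · refine (mul_eq_zero.1 (?_ : _ * ((χ g ^ k) ^ (Nat.card G / p) - 1) = 0)).resolve_right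
        (sub_ne_zero.2 hne)
      rw [geom_sum_mul, ← pow_mul, hd, ← map_pow, ← map_pow, pow_card_eq_one', map_one, sub_self]
    · intro h hh
      obtain ⟨j, rfl⟩ := mem_powers_iff_mem_zpowers.2 hh
      rw [MonoidHom.pow_apply, ← map_pow]
      simp only
      rw [← pow_mul, ← pow_mul, mul_left_comm, mul_comm p, hd, mul_comm j, pow_mul,
        pow_card_eq_one', one_pow, map_one]
    · rwa [MonoidHom.pow_apply, map_pow]

theorem aeval_cyclotomic_mem [IsAlgClosed K] [CharZero K]
    (hg : ∀ x, x ∈ Submonoid.powers g) (hχ : IsPrimitiveRoot (χ g) (Nat.card G)) :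
    aeval (linearClass χ) (cyclotomic (Nat.card G) ℤ) ∈
      ⨆ H : {H : Subgroup G // H < ⊤}, indIdeal K (H : Subgroup G) := by
  -- The trivial group has no proper subgroup, but there `Φ_1([χ]) = [χ] - 1 = 0`.
  rcases (Nat.one_le_iff_ne_zero.2 (Nat.card_pos (α := G)).ne').eq_or_lt with h1 | h1
  · have h := linearClass_pow_card χ
    rw [← h1, pow_one] at h
    rw [← h1, cyclotomic_one, map_sub, aeval_X, h, map_one, sub_self]
    exact zero_mem _
  · refine Ideal.mem_comap.1 ((Ideal.span_le (I := Ideal.comap (aeval (linearClass χ)) _)).2 ?_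
      (cyclotomic_mem_span_geom_sum h1))
    rintro _ ⟨p, hp, hpn, rfl⟩
    rw [SetLike.mem_coe, Ideal.mem_comap]
    rw [aeval_geom_sum_eq_indHom_one hg hχ hpn]
    have hlt : Subgroup.zpowers (g ^ p) < ⊤ := lt_top_iff_ne_top.2 fun htop => hp.ne_one (by
      rw [← index_zpowers_pow hg hpn, htop, Subgroup.index_top])
    exact le_iSup (fun H : {H : Subgroup G // H < ⊤} => indIdeal K (H : Subgroup G)) ⟨_, hlt⟩
      ⟨1, rfl⟩

/-- The character `χ ^ |H|` is trivial on `H`, whereas its value `ζ ^ |H|` at `g` is not `1` because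
`0 < |H| < n`. -/
theorem iSup_indIdeal_le_ker_char (hχ : IsPrimitiveRoot (χ g) (Nat.card G)) :
    ⨆ H : {H : Subgroup G // H < ⊤}, indIdeal K (H : Subgroup G) ≤
      RingHom.ker (RepRing.char (K := K) g) := by
  refine iSup_le fun ⟨H, hH⟩ => ?_
  rintro _ ⟨y, rfl⟩
  refine char_indHom_eq_zero H (θ := χ ^ Nat.card H) (fun h hh => ?_) ?_ y
  · have : h ^ Nat.card H = 1 := congrArg Subtype.val (pow_card_eq_one' (x := (⟨h, hh⟩ : H)))
    rw [MonoidHom.pow_apply, ← map_pow, this, map_one]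
  · rw [MonoidHom.pow_apply]
    refine hχ.pow_ne_one_of_pos_of_lt Nat.card_pos.ne' ?_
    exact lt_of_le_of_ne H.card_le_card_group fun h => hH.ne (Subgroup.eq_top_of_card_eq H h)

theorem exists_isPrimitiveRoot_apply [IsAlgClosed K] [CharZero K]
    (hg : ∀ x, x ∈ Submonoid.powers g) :
    ∃ χ : G →* K, IsPrimitiveRoot (χ g) (Nat.card G) := by
  have : NeZero (Nat.card G) := ⟨Nat.card_pos.ne'⟩
  have hz (x : G) : x ∈ Subgroup.zpowers g := mem_powers_iff_mem_zpowers.1 (hg x)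
  obtain ⟨ζ, hζ⟩ := HasEnoughRootsOfUnity.exists_primitiveRoot K (Nat.card G)
  obtain ⟨ζ, rfl⟩ := hζ.isUnit Nat.card_pos.ne'
  have hdvd : orderOf ζ ∣ orderOf g := by
    rw [orderOf_eq_card_of_forall_mem_zpowers hz, ← orderOf_units, ← hζ.eq_orderOf]
  refine ⟨(Units.coeHom K).comp (monoidHomOfForallMemZpowers hz hdvd), ?_⟩
  simpa using hζ

end Cyclic

end

theorem theorem1 {K : Type u} {G : Type v} [Field K] [IsAlgClosed K] [CharZero K]
    [Group G] [Finite G] [IsCyclic G] (n : ℕ) (hn : Nat.card G = n) :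
    Nonempty ((RepRing K G ⧸ ⨆ H : {H : Subgroup G // H < ⊤}, indIdeal K (H : Subgroup G)) ≃+*
      (Polynomial ℤ ⧸ Ideal.span {Polynomial.cyclotomic n ℤ})) := by
  subst hn
  obtain ⟨g, hz⟩ := IsCyclic.exists_generator (α := G)
  have hg (x : G) : x ∈ Submonoid.powers g := mem_powers_iff_mem_zpowers.2 (hz x)
  obtain ⟨χ, hχ⟩ := exists_isPrimitiveRoot_apply (K := K) hg
  let I : Ideal (RepRing K G) := ⨆ H : {H : Subgroup G // H < ⊤}, indIdeal K (H : Subgroup G)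
  let φ : Polynomial ℤ →+* RepRing K G ⧸ I :=
    (Ideal.Quotient.mk I).comp (Polynomial.aeval (R := ℤ) (linearClass χ)).toRingHom
  have hφ : Function.Surjective φ :=
    Ideal.Quotient.mk_surjective.comp (aeval_linearClass_surjective hg hχ)
  have hker : RingHom.ker φ = Ideal.span {Polynomial.cyclotomic (Nat.card G) ℤ} := by
    refine le_antisymm (fun f hf => ?_) ((Ideal.span_singleton_le_iff_mem _).2 ?_)
    · have hI : Polynomial.aeval (linearClass χ) f ∈ I := Ideal.Quotient.eq_zero_iff_mem.1 hf
      -- The character value at `g` gives `f(ζ) = 0`; since `ℤ` is integrally closed, the minimal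
      -- polynomial `Φ_n` of `ζ` divides `f` already in `ℤ[X]`.
      have h0 := iSup_indIdeal_le_ker_char hχ hI
      rw [RingHom.mem_ker, char_aeval_linearClass] at h0
      rw [Ideal.mem_span_singleton, Polynomial.cyclotomic_eq_minpoly hχ Nat.card_pos]
      exact minpoly.isIntegrallyClosed_dvd (hχ.isIntegral Nat.card_pos) h0
    · exact Ideal.Quotient.eq_zero_iff_mem.2 (aeval_cyclotomic_mem hg hχ)
  exact ⟨((Ideal.quotEquivOfEq hker.symm).trans
    (RingHom.quotientKerEquivOfSurjective hφ)).symm⟩
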